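/- **Theorem (Analyticity).** Let $\mathcal L$ be one of the fifteen normal modal logics of the modal cube, $$\mathsf{K},\mathsf{KB},\mathsf{K4},\mathsf{K5},\mathsf{K45};\quad \mathsf{KD},\mathsf{KDB},\mathsf{KD4},\mathsf{KD5},\mathsf{KD45};\quad \mathsf{KT},\mathsf{KTB},\mathsf{KT4},\mathsf{KTB45};\quad \mathsf{KB45},$$ and let $\mathcal M$ be its Nmatrix, defined below. Let $\Lambda$ be a set of formulas closed under subformulas. Then every partial level-valuation $v$ of $\mathcal L$ with domain $\Lambda$ extends to a level-valuation: there is $u\in\mathcal L(\mathcal M)$ with $u(\alpha)=v(\alpha)$ for all $\alpha\in\Lambda$. *Formulas* are $\alpha ::= p\mid\bot\mid\alpha\to\alpha\mid\Box\alpha$. There are eight truth values, each recording which of "$\alpha$ is true", "$\alpha$ is necessary", "$\alpha$ is possible" hold. Put $$\mathcal D=\{T,t,tt,ttt\},\quad N=\{T,tt,fff,ff\},\quad I=\{F,ff,ttt,tt\},\quad P=\{T,t,fff,f\},\quad PN=\{F,f,ttt,t\}.$$ The set $\mathcal V$ of values of $\mathcal L$ consists of all eight values $F,f,ff,fff,ttt,tt,t,T$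 for $\mathsf K,\mathsf{KB},\mathsf{K4},\mathsf{K5},\mathsf{K45}$; of $F,f,fff,ttt,t,T$ for $\mathsf{KD},\mathsf{KDB},\mathsf{KD4},\mathsf{KD5},\mathsf{KD45}$; of $F,f,t,T$ for $\mathsf{KT},\mathsf{KTB},\mathsf{KT4},\mathsf{KTB45}$; and of $F,f,ff,tt,t,T$ for $\mathsf{KB45}$. The designated values are $\mathcal D\cap\mathcal V$. *Nmatrix.* The multifunctions, with values intersected with $\mathcal V$, are $\tilde\bot=\{F,ff\}$; the implication table (rows: value of $\alpha$, columns: value of $\beta$, entries: possible values of $\alpha\to\beta$, set braces omitted) $$\begin{array}{c|cccccccc} \tilde\to&F&f&ff&fff&ttt&tt&t&T\\\hline F&T&T&T&T&T&T&T&T\\ f&t&T,t&tt&T&t&T&T,t&T\\ ff&ttt&t&tt&T&ttt&tt&t&T\\ fff&ttt&t&tt&T&ttt&tt&t&T\\ ttt&fff&fff&fff&fff&T&T&T&T\\ tt&F&f&ff&fff&ttt&tt&ttt&T\\ t&f&f,fff&fff&fff&t&T&T,t&T\\ T&F&f&ff&fff&ttt&tt&t&T \end{array}$$ and the table of $\tilde\Box$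 for $\mathcal L$ (rows: value of $\alpha$, entries: possible values of $\Box\alpha$; a dash marks a value not in $\mathcal V$) $$\begin{array}{c|ccccc|c} &\mathsf K&\mathsf{KB}&\mathsf{K4}&\mathsf{K5}&\mathsf{K45}&\mathsf{KB45}\\\hline F&F,f,fff&F&F,f,fff&F&F&F\\ f&F,f,fff&F&F,f,fff&F&F&F\\ ff&tt&tt&tt&tt&tt&tt\\ fff&T,t,ttt&ttt&T&T,ttt&T&-\\ ttt&F,f,fff&F,f,fff&F,f,fff&F&F&-\\ tt&tt&tt&tt&tt&tt&tt\\ t&F,f,fff&F,f,fff&F,f,fff&F&F&F\\ T&T,t,ttt&T,t,ttt&T&T,ttt&T&T \end{array}$$ $$\begin{array}{c|ccccc|cccc} &\mathsf{KD}&\mathsf{KDB}&\mathsf{KD4}&\mathsf{KD5}&\mathsf{KD45}&\mathsf{KT}&\mathsf{KTB}&\mathsf{KT4}&\mathsf{KTB45}\\\hline F&F,f,fff&F&F&F&F&F&F&F&F\\ f&F,f,fff&F&F,f,fff&F&F&F,f&F&F,f&F\\ fff&T,t,ttt&ttt&T&T,ttt&T&-&-&-&-\\ ttt&F,f,fff&F,f,fff&F&F&F&-&-&-&-\\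 t&F,f,fff&F,f,fff&F,f,fff&F&F&F,f&F,f&F,f&F\\ T&T,t,ttt&T,t,ttt&T&T,ttt&T&T,t&T,t&T&T \end{array}$$ *Valuations.* A partial valuation with domain $\Lambda$ is a function $v:\Lambda\to\mathcal V$ such that $v(\bot)\in\tilde\bot$, $v(\alpha\to\beta)\in\tilde\to(v(\alpha),v(\beta))$ and $v(\Box\alpha)\in\tilde\Box(v(\alpha))$ whenever the compound formula lies in $\Lambda$. It is a (total) valuation if $\Lambda$ is the set of all formulas. *Level-valuations.* $\mathcal L_0(\mathcal M)$ is the set of valuations $v$ such that, if $v(\alpha)\in\{ff,tt\}$ for some $\alpha$, then $v(\beta)\in\{ff,tt\}$ for all $\beta$. $\mathcal L_{n+1}(\mathcal M)$ is the set of $v\in\mathcal L_n(\mathcal M)$ such that $v(\alpha)\in\{T,tt\}$ for every formula $\alpha$ with $w(\alpha)\in\mathcal D$ for all $w\in\mathcal L_n(\mathcal M)$. The set of level-valuations is $\mathcal L(\mathcal M)=\bigcap_{n\ge0}\mathcal L_n(\mathcal M)$. *Models.* An $\mathcal L$-model on $\Lambda$ is a pair $\langle\Pi,R\rangle$, where $\Pi$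 is a set of partial valuations with domain $\Lambda$ and $R\subseteq\Pi\times\Pi$, such that for all $\alpha\in\Lambda$: 1. if $w\in\Pi$ and $w(\alpha)\in P$, there is $w'\in\Pi$ with $wRw'$ and $w'(\alpha)\in\mathcal D$; if $w\in\Pi$ and $w(\alpha)\in PN$, there is $w'\in\Pi$ with $wRw'$ and $w'(\alpha)\notin\mathcal D$; 2. if $wRw'$, then $w(\alpha)\in N$ implies $w'(\alpha)\in\mathcal D$, and $w(\alpha)\in I$ implies $w'(\alpha)\notin\mathcal D$; 3. for each of the axioms D, T, B, 4, 5 that is valid in $\mathcal L$, the corresponding condition holds for all $w,w',w''\in\Pi$: - D ($\Box\alpha\to\Diamond\alpha$): $w(\alpha)\in N$ implies $w(\alpha)\in P$, and $w(\alpha)\in I$ implies $w(\alpha)\in PN$; - T ($\Box\alpha\to\alpha$): $w(\alpha)\in N$ implies $w(\alpha)\in\mathcal D$, and $w(\alpha)\in I$ implies $w(\alpha)\notin\mathcal D$; - B ($\alpha\to\Box\Diamond\alpha$): if $wRw'$, then $w(\alpha)\in\mathcal D$ implies $w'(\alpha)\in P$, and $w(\alpha)\notin\mathcal D$ implies $w'(\alpha)\in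 PN$; - 4 ($\Box\alpha\to\Box\Box\alpha$): if $wRw'$, then $w(\alpha)\in N$ implies $w'(\alpha)\in N$, and $w(\alpha)\in I$ implies $w'(\alpha)\in I$; - 5 ($\Diamond\alpha\to\Box\Diamond\alpha$): if $wRw'$, then $w(\alpha)\in P$ implies $w'(\alpha)\in P$, and $w(\alpha)\in PN$ implies $w'(\alpha)\in PN$; moreover, if $wRw'$ and ($wRw''$ or $w'Rw''$), then $w(\alpha),w'(\alpha)\in N$ implies $w''(\alpha)\in N$, and $w(\alpha),w'(\alpha)\in I$ implies $w''(\alpha)\in I$. A *partial level-valuation* of $\mathcal L$ with domain $\Lambda$ is an element of $\Pi$ for some $\mathcal L$-model $\langle\Pi,R\rangle$ on $\Lambda$. -/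

import Mathlib

universe u

namespace ModalCube

/-- Modal formulas over a set `At` of propositional variables. -/
inductive Form (At : Type u) : Type u
  | atom (p : At) : Form At
  | bot : Form At
  | imp (α β : Form At) : Form At
  | box (α : Form At) : Form At

/-- The eight truth values. -/
inductive TV : Type
  | F | f | ff | fff | ttt | tt | t | T
  deriving DecidableEq

open TV

/-- The designated values (the formula is true). -/
def setD : Finset TV := {T, t, tt, ttt}
/-- The values saying that the formula is necessary. -/
def setN : Finset TV := {T, tt, fff, ff}
/-- The values saying that the negation of the formula is necessary. -/
def setI : Finset TV := {F, ff, ttt, tt}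
/-- The values saying that the formula is possible. -/
def setP : Finset TV := {T, t, fff, f}
/-- The values saying that the negation of the formula is possible. -/
def setPN : Finset TV := {F, f, ttt, t}

/-- The fifteen normal modal logics of the modal cube
(`KT4` is `S4`, `KTB45` is `S5`, `KB45` is `KB5`). -/
inductive Logic : Type
  | K | KB | K4 | K5 | K45
  | KD | KDB | KD4 | KD5 | KD45
  | KT | KTB | KT4 | KTB45
  | KB45
  deriving DecidableEq

/-- The five modal axioms that extend `K`: `D : □α → ◇α`, `T : □α → α`, `B : α → □◇α`,
`four : □α → □□α`, `five : ◇α → □◇α`. -/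
inductive Ax : Type
  | D | T | B | four | five
  deriving DecidableEq

/-- The axioms among `D, T, B, 4, 5` that are valid in the logic (derivable ones included). -/
def Logic.axioms : Logic → Finset Ax
  | .K => ∅
  | .KB => {.B}
  | .K4 => {.four}
  | .K5 => {.five}
  | .K45 => {.four, .five}
  | .KD => {.D}
  | .KDB => {.D, .B}
  | .KD4 => {.D, .four}
  | .KD5 => {.D, .five}
  | .KD45 => {.D, .four, .five}
  | .KT => {.D, .T}
  | .KTB => {.D, .T, .B}
  | .KT4 => {.D, .T, .four}
  | .KTB45 => {.D, .T, .B, .four, .five}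
  | .KB45 => {.B, .four, .five}

/-- The admissible truth values of a logic. -/
def Logic.values : Logic → Finset TV
  | .K | .KB | .K4 | .K5 | .K45 => {F, f, ff, fff, ttt, tt, t, T}
  | .KD | .KDB | .KD4 | .KD5 | .KD45 => {F, f, fff, ttt, t, T}
  | .KT | .KTB | .KT4 | .KTB45 => {F, f, t, T}
  | .KB45 => {F, f, ff, tt, t, T}

/-- The multifunction for `⊥`, common to all logics. -/
def botTable : Finset TV := {F, ff}

/-- The multifunction for `→`, common to all logics (first argument: the antecedent). -/
def impTable : TV → TV → Finset TV
  | F, _ => {T}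
  | f, F => {t}
  | f, f => {T, t}
  | f, ff => {tt}
  | f, fff => {T}
  | f, ttt => {t}
  | f, tt => {T}
  | f, t => {T, t}
  | f, T => {T}
  | ff, F => {ttt}
  | ff, f => {t}
  | ff, ff => {tt}
  | ff, fff => {T}
  | ff, ttt => {ttt}
  | ff, tt => {tt}
  | ff, t => {t}
  | ff, T => {T}
  | fff, F => {ttt}
  | fff, f => {t}
  | fff, ff => {tt}
  | fff, fff => {T}
  | fff, ttt => {ttt}
  | fff, tt => {tt}
  | fff, t => {t}
  | fff, T => {T}
  | ttt, F => {fff}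
  | ttt, f => {fff}
  | ttt, ff => {fff}
  | ttt, fff => {fff}
  | ttt, ttt => {T}
  | ttt, tt => {T}
  | ttt, t => {T}
  | ttt, T => {T}
  | tt, F => {F}
  | tt, f => {f}
  | tt, ff => {ff}
  | tt, fff => {fff}
  | tt, ttt => {ttt}
  | tt, tt => {tt}
  | tt, t => {ttt}
  | tt, T => {T}
  | t, F => {f}
  | t, f => {f, fff}
  | t, ff => {fff}
  | t, fff => {fff}
  | t, ttt => {t}
  | t, tt => {T}
  | t, t => {T, t}
  | t, T => {T}
  | T, F => {F}
  | T, f => {f}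
  | T, ff => {ff}
  | T, fff => {fff}
  | T, ttt => {ttt}
  | T, tt => {tt}
  | T, t => {t}
  | T, T => {T}

/-- The multifunction for `□` in each logic. A value that the logic does not admit is sent
to `∅`; no valuation of that logic takes it. -/
def boxTable : Logic → TV → Finset TV
  -- family K
  | .K, F => {F, f, fff}
  | .K, f => {F, f, fff}
  | .K, ff => {tt}
  | .K, fff => {T, t, ttt}
  | .K, ttt => {F, f, fff}
  | .K, tt => {tt}
  | .K, t => {F, f, fff}
  | .K, T => {T, t, ttt}
  | .KB, F => {F}
  | .KB, f => {F}
  | .KB, ff => {tt}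
  | .KB, fff => {ttt}
  | .KB, ttt => {F, f, fff}
  | .KB, tt => {tt}
  | .KB, t => {F, f, fff}
  | .KB, T => {T, t, ttt}
  | .K4, F => {F, f, fff}
  | .K4, f => {F, f, fff}
  | .K4, ff => {tt}
  | .K4, fff => {T}
  | .K4, ttt => {F, f, fff}
  | .K4, tt => {tt}
  | .K4, t => {F, f, fff}
  | .K4, T => {T}
  | .K5, F => {F}
  | .K5, f => {F}
  | .K5, ff => {tt}
  | .K5, fff => {T, ttt}
  | .K5, ttt => {F}
  | .K5, tt => {tt}
  | .K5, t => {F}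
  | .K5, T => {T, ttt}
  | .K45, F => {F}
  | .K45, f => {F}
  | .K45, ff => {tt}
  | .K45, fff => {T}
  | .K45, ttt => {F}
  | .K45, tt => {tt}
  | .K45, t => {F}
  | .K45, T => {T}
  -- family KB45
  | .KB45, F => {F}
  | .KB45, f => {F}
  | .KB45, ff => {tt}
  | .KB45, tt => {tt}
  | .KB45, t => {F}
  | .KB45, T => {T}
  -- family KD
  | .KD, F => {F, f, fff}
  | .KD, f => {F, f, fff}
  | .KD, fff => {T, t, ttt}
  | .KD, ttt => {F, f, fff}
  | .KD, t => {F, f, fff}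
  | .KD, T => {T, t, ttt}
  | .KDB, F => {F}
  | .KDB, f => {F}
  | .KDB, fff => {ttt}
  | .KDB, ttt => {F, f, fff}
  | .KDB, t => {F, f, fff}
  | .KDB, T => {T, t, ttt}
  | .KD4, F => {F}
  | .KD4, f => {F, f, fff}
  | .KD4, fff => {T}
  | .KD4, ttt => {F}
  | .KD4, t => {F, f, fff}
  | .KD4, T => {T}
  | .KD5, F => {F}
  | .KD5, f => {F}
  | .KD5, fff => {T, ttt}
  | .KD5, ttt => {F}
  | .KD5, t => {F}
  | .KD5, T => {T, ttt}
  | .KD45, F => {F}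
  | .KD45, f => {F}
  | .KD45, fff => {T}
  | .KD45, ttt => {F}
  | .KD45, t => {F}
  | .KD45, T => {T}
  -- family KT
  | .KT, F => {F}
  | .KT, f => {F, f}
  | .KT, t => {F, f}
  | .KT, T => {T, t}
  | .KTB, F => {F}
  | .KTB, f => {F}
  | .KTB, t => {F, f}
  | .KTB, T => {T, t}
  | .KT4, F => {F}
  | .KT4, f => {F, f}
  | .KT4, t => {F, f}
  | .KT4, T => {T}
  | .KTB45, F => {F}
  | .KTB45, f => {F}
  | .KTB45, t => {F}
  | .KTB45, T => {T}
  | _, _ => ∅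

/-- A non-deterministic matrix for the language `⊥, →, □` with truth values among the eight. -/
structure NMatrix : Type where
  /-- the truth values of the matrix -/
  values : Finset TV
  /-- the designated values -/
  designated : Finset TV
  /-- the multifunction for `⊥` -/
  bot : Finset TV
  /-- the multifunction for `→` -/
  imp : TV → TV → Finset TV
  /-- the multifunction for `□` -/
  box : TV → Finset TV

/-- The Nmatrix associated to a logic of the modal cube. -/
def Logic.matrix (L : Logic) : NMatrix where
  values := L.values
  designated := L.values ∩ setD
  bot := botTable ∩ L.values
  imp a b := impTable a b ∩ L.values
  box a := boxTable L a

variable {At : Type u}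

/-- Closure of a set of formulas under subformulas. -/
structure SubformulaClosed (Λ : Set (Form At)) : Prop where
  imp_left : ∀ α β : Form At, Form.imp α β ∈ Λ → α ∈ Λ
  imp_right : ∀ α β : Form At, Form.imp α β ∈ Λ → β ∈ Λ
  box : ∀ α : Form At, Form.box α ∈ Λ → α ∈ Λ

/-- `v : Λ → TV` is a partial valuation in the Nmatrix `M` (with domain `Λ`). -/
structure IsPartialValuation (M : NMatrix) (Λ : Set (Form At)) (v : Λ → TV) : Prop where
  values : ∀ α : Λ, v α ∈ M.values
  bot : ∀ γ : Λ, γ.1 = Form.bot → v γ ∈ M.bot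
  imp : ∀ α β γ : Λ, γ.1 = Form.imp α.1 β.1 → v γ ∈ M.imp (v α) (v β)
  box : ∀ α γ : Λ, γ.1 = Form.box α.1 → v γ ∈ M.box (v α)

/-- `v` is a (total) valuation in `M`. -/
def IsValuation (M : NMatrix) (v : Form At → TV) : Prop :=
  IsPartialValuation M Set.univ (fun α => v α.1)

/-- The `n`-level-valuations of `M`. -/
def levelN (At : Type u) (M : NMatrix) : ℕ → Set (Form At → TV)
  | 0 => {v | IsValuation M v ∧
      ((∃ α, v α ∈ ({ff, tt} : Finset TV)) → ∀ β, v β ∈ ({ff, tt} : Finset TV))}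
  | n + 1 => {v | v ∈ levelN At M n ∧
      ∀ α, (∀ w ∈ levelN At M n, w α ∈ M.designated) → v α ∈ ({T, tt} : Finset TV)}

/-- The level-valuations of `M`. -/
def levelValuations (At : Type u) (M : NMatrix) : Set (Form At → TV) :=
  ⋂ n : ℕ, levelN At M n

variable {Λ : Set (Form At)}

/-- The condition of necessitation, imposed in every logic. -/
def CondNec (R : (Λ → TV) → (Λ → TV) → Prop) : Prop :=
  ∀ w w' : Λ → TV, R w w' → ∀ α : Λ,
    (w α ∈ setN → w' α ∈ setD) ∧ (w α ∈ setI → w' α ∉ setD)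

/-- The condition for a modal axiom on a set `S` of partial valuations and a relation `R`
on it. -/
def Cond (S : Set (Λ → TV)) (R : (Λ → TV) → (Λ → TV) → Prop) : Ax → Prop
  | .T => ∀ w ∈ S, ∀ α : Λ, (w α ∈ setN → w α ∈ setD) ∧ (w α ∈ setI → w α ∉ setD)
  | .D => ∀ w ∈ S, ∀ α : Λ, (w α ∈ setN → w α ∈ setP) ∧ (w α ∈ setI → w α ∈ setPN)
  | .B => ∀ w w' : Λ → TV, R w w' → ∀ α : Λ,
      (w α ∈ setD → w' α ∈ setP) ∧ (w α ∉ setD → w' α ∈ setPN)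
  | .four => ∀ w w' : Λ → TV, R w w' → ∀ α : Λ,
      (w α ∈ setN → w' α ∈ setN) ∧ (w α ∈ setI → w' α ∈ setI)
  | .five =>
      (∀ w w' : Λ → TV, R w w' → ∀ α : Λ,
        (w α ∈ setP → w' α ∈ setP) ∧ (w α ∈ setPN → w' α ∈ setPN)) ∧
      (∀ w w' w'' : Λ → TV, R w w' → (R w w'' ∨ R w' w'') → ∀ α : Λ,
        (w α ∈ setN → w' α ∈ setN → w'' α ∈ setN) ∧
        (w α ∈ setI → w' α ∈ setI → w'' α ∈ setI))

/-- `⟨S, R⟩` is an `L`-model on the domain `Λ`. The fields up to `exists_not_designated` say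
that it is a pre-model. -/
structure IsModel (L : Logic) (Λ : Set (Form At)) (S : Set (Λ → TV))
    (R : (Λ → TV) → (Λ → TV) → Prop) : Prop where
  valuation : ∀ v ∈ S, IsPartialValuation L.matrix Λ v
  rel_mem : ∀ v w, R v w → v ∈ S ∧ w ∈ S
  exists_designated : ∀ v ∈ S, ∀ α : Λ, v α ∈ setP →
    ∃ w ∈ S, R v w ∧ w α ∈ L.matrix.designated
  exists_not_designated : ∀ v ∈ S, ∀ α : Λ, v α ∈ setPN →
    ∃ w ∈ S, R v w ∧ w α ∉ L.matrix.designated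
  nec : CondNec R
  cond : ∀ a ∈ L.axioms, Cond S R a

/-- `v` is a partial level-valuation of `L`: it belongs to some `L`-model on its domain. -/
def IsPartialLevelValuation (L : Logic) (Λ : Set (Form At)) (v : Λ → TV) : Prop :=
  ∃ (S : Set (Λ → TV)) (R : (Λ → TV) → (Λ → TV) → Prop), IsModel L Λ S R ∧ v ∈ S

end ModalCube

namespace ModalCube

open TV

variable {At : Type u} {Λ : Set (Form At)} {L : Logic}

/-! A value is a triple of bits (true, necessary, impossible), so every world of a Kripke model
gives a value to every formula. On a frame for `L` these assignments are level-valuations: the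
tables encode modal principles valid on the frame, and a formula designated by all valuations of a
level is true at every world, hence necessary at each.

It remains to turn the given `L`-model into such a Kripke model. Its partial valuations serve as
worlds, but its relation may fail the frame conditions. `exists_isFrame` enlarges the relation until
they hold, while necessitation still holds along the new edges. The old witnesses for `setP` and
`setPN` survive, so `setN` and `setI` still describe the successors, and the truth lemma `sat_iff`
identifies truth with designation on `Λ`. The world `v` then values all formulas and agrees with `v`
on `Λ`. -/

instance : Fintype TV where
  elems := {F, f, ff, fff, ttt, tt, t, T}
  complete x := by cases x <;> decide

instance : Fintype Logic where
  elems := {.K, .KB, .K4, .K5, .K45, .KD, .KDB, .KD4, .KD5, .KD45, .KT, .KTB, .KT4, .KTB45, .KB45}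
  complete x := by cases x <;> decide

/-! ### Truth values as triples of bits -/

/-- The truth value that records whether a formula is true, necessary, impossible. -/
def TV.ofBits : Bool → Bool → Bool → TV
  | true, true, true => tt
  | true, true, false => T
  | true, false, true => ttt
  | true, false, false => t
  | false, true, true => ff
  | false, true, false => fff
  | false, false, true => F
  | false, false, false => f

lemma ofBits_mem_setD : ∀ d n i, ofBits d n i ∈ setD ↔ d = true := by decide
lemma ofBits_mem_ff_tt : ∀ d n i,
    ofBits d n i ∈ ({ff, tt} : Finset TV) ↔ n = true ∧ i = true := by decide
lemma ofBits_mem_T_tt : ∀ d n i,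
    ofBits d n i ∈ ({T, tt} : Finset TV) ↔ d = true ∧ n = true := by decide
lemma ofBits_self : ∀ x : TV,
    ofBits (decide (x ∈ setD)) (decide (x ∈ setN)) (decide (x ∈ setI)) = x := by decide

lemma mem_setP_iff : ∀ x : TV, x ∈ setP ↔ x ∉ setI := by decide
lemma mem_setPN_iff : ∀ x : TV, x ∈ setPN ↔ x ∉ setN := by decide

lemma notMem_setD_of_mem_botTable : ∀ c ∈ botTable, c ∉ setD := by decide

lemma mem_setD_of_mem_impTable : ∀ a b : TV, ∀ c ∈ impTable a b,
    (c ∈ setD ↔ (a ∈ setD → b ∈ setD)) := by decide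

lemma mem_setD_of_mem_boxTable : ∀ L, ∀ a : TV, ∀ c ∈ boxTable L a,
    (c ∈ setD ↔ a ∈ setN) := by
  intro L; cases L <;> decide

set_option synthInstance.maxSize 1000 in
-- The hypothesis for B with 4 covers `KB45`: a world of a symmetric transitive frame is blind or
-- sees itself.
lemma ofBits_mem_values : ∀ (L : Logic) (d n i : Bool),
    (.D ∈ L.axioms → ¬(n = true ∧ i = true)) →
    (.T ∈ L.axioms → (n = true → d = true) ∧ (i = true → d = false)) →
    (.B ∈ L.axioms → .four ∈ L.axioms →
      n = true ∧ i = true ∨ (n = true → d = true) ∧ (i = true → d = false)) →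
    ofBits d n i ∈ L.values := by
  intro L; cases L <;> decide

/-- The hypotheses are principles of `K` for the bits of `α`, `β` and `α → β`. The last one holds
because being both necessary and impossible means having no successor, which does not depend on the
formula. -/
lemma ofBits_mem_impTable : ∀ (d n i d' n' i' e m j : Bool),
    (e = true ↔ (d = true → d' = true)) →
    (i = true → m = true) → (n' = true → m = true) →
    (n = true → m = true → n' = true) → (i' = true → m = true → i = true) →
    (j = true ↔ n = true ∧ i' = true) →
    (n = true ∧ i = true ↔ n' = true ∧ i' = true) →
    ofBits e m j ∈ impTable (ofBits d n i) (ofBits d' n' i') := by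
  decide

set_option synthInstance.maxSize 1000 in
-- The bits are those of `α` and `□α`, which share `n`: it says both that `α` is necessary and that
-- `□α` is true. Each axiom contributes the principles it makes valid; under 5, for instance, `□□α ∨
-- □¬□α`.
lemma ofBits_mem_boxTable : ∀ (L : Logic) (d n i m j : Bool),
    (n = true ∧ i = true ↔ m = true ∧ j = true) →
    ofBits d n i ∈ L.values → ofBits n m j ∈ L.values →
    (.B ∈ L.axioms → d = false → j = true) →
    (.four ∈ L.axioms → n = true → m = true) →
    (.D ∈ L.axioms → .four ∈ L.axioms → i = true → j = true) →
    (.T ∈ L.axioms → i = true → j = true) →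
    (.five ∈ L.axioms → (n = false → j = true) ∧ (m = true ∨ j = true)) →
    ofBits n m j ∈ boxTable L (ofBits d n i) := by
  intro L; cases L <;> decide

/-! ### Kripke semantics -/

section Kripke

variable {W : Type*} (R : W → W → Prop) (V : At → W → Prop)

/-- Truth of a formula at a world of a Kripke model. -/
def Sat : Form At → W → Prop
  | .atom p, w => V p w
  | .bot, _ => False
  | .imp α β, w => Sat α w → Sat β w
  | .box α, w => ∀ w', R w w' → Sat α w'

open Classical in
/-- The truth value of a formula at a world of a Kripke model. -/
noncomputable def kripkeValue (w : W) (α : Form At) : TV :=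
  ofBits (decide (Sat R V α w)) (decide (∀ w', R w w' → Sat R V α w'))
    (decide (∀ w', R w w' → ¬Sat R V α w'))

/-- The frame conditions that correspond to the modal axioms of the logic `L`. -/
structure IsFrame (L : Logic) (R : W → W → Prop) : Prop where
  serial : .D ∈ L.axioms → ∀ w, ∃ w', R w w'
  refl : .T ∈ L.axioms → ∀ w, R w w
  symm : .B ∈ L.axioms → ∀ w w', R w w' → R w' w
  trans : .four ∈ L.axioms → ∀ x y z, R x y → R y z → R x z
  eucl : .five ∈ L.axioms → ∀ x y z, R x y → R x z → R y z

variable {R}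

lemma IsFrame.kripkeValue_mem_values (hR : IsFrame L R) (w : W) (α : Form At) :
    kripkeValue R V w α ∈ L.values := by
  apply ofBits_mem_values <;> simp only [decide_eq_true_eq, decide_eq_false_iff_not]
  · rintro hD ⟨h₁, h₂⟩
    obtain ⟨w', h⟩ := hR.serial hD w
    exact h₂ w' h (h₁ w' h)
  · exact fun hT => ⟨fun h => h w (hR.refl hT w), fun h => h w (hR.refl hT w)⟩
  · intro hB h4
    by_cases hw : ∃ w', R w w'
    · obtain ⟨w', h⟩ := hw
      have hww := hR.trans h4 _ _ _ h (hR.symm hB _ _ h)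
      exact .inr ⟨fun h => h w hww, fun h => h w hww⟩
    · push Not at hw
      exact .inl ⟨fun w' h => absurd h (hw w'), fun w' h => absurd h (hw w')⟩

/-- The right side does not mention `α`: at a given world either all formulas take values in `{ff,
tt}` or none does, as level 0 demands. -/
lemma forall_sat_and_forall_not_sat_iff (w : W) (α : Form At) :
    ((∀ w', R w w' → Sat R V α w') ∧ ∀ w', R w w' → ¬Sat R V α w') ↔ ∀ w', ¬R w w' :=
  ⟨fun h w' hw => h.2 w' hw (h.1 w' hw),
    fun h => ⟨fun w' hw => absurd hw (h w'), fun w' hw => absurd hw (h w')⟩⟩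

lemma IsFrame.kripkeValue_isValuation (hR : IsFrame L R) (w : W) :
    IsValuation L.matrix (kripkeValue R V w) := by
  have hval := hR.kripkeValue_mem_values V w
  refine ⟨fun α => hval α.1, ?_, ?_, ?_⟩
  · rintro ⟨γ, -⟩ rfl
    refine Finset.mem_inter.2 ⟨?_, hval _⟩
    have : ∀ d n i : Bool, d = false → i = true → ofBits d n i ∈ botTable := by decide
    apply this <;> simp only [decide_eq_true_eq, decide_eq_false_iff_not]
    · exact id
    · exact fun _ _ => id
  · rintro ⟨α, -⟩ ⟨β, -⟩ ⟨γ, -⟩ rfl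
    refine Finset.mem_inter.2 ⟨?_, hval _⟩
    apply ofBits_mem_impTable <;> simp only [decide_eq_true_eq]
    · rfl
    · exact fun h w' hw hα => absurd hα (h w' hw)
    · exact fun h w' hw _ => h w' hw
    · exact fun h h' w' hw => h' w' hw (h w' hw)
    · exact fun h h' w' hw hα => h w' hw (h' w' hw hα)
    · simp only [Sat, Classical.not_imp]
      exact ⟨fun h => ⟨fun w' hw => (h w' hw).1, fun w' hw => (h w' hw).2⟩,
        fun h w' hw => ⟨h.1 w' hw, h.2 w' hw⟩⟩
    · rw [forall_sat_and_forall_not_sat_iff, forall_sat_and_forall_not_sat_iff]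
  · rintro ⟨α, -⟩ ⟨γ, -⟩ rfl
    have h := hval (.box α)
    apply ofBits_mem_boxTable L _ _ _ _ _ _ (hval α) h <;>
      simp only [decide_eq_true_eq, decide_eq_false_iff_not]
    · intro hB hα w' hw hbox
      exact hα (hbox w (hR.symm hB _ _ hw))
    · exact fun h4 hα w' hw w'' hw' => hα w'' (hR.trans h4 _ _ _ hw hw')
    · intro hD h4 hα w' hw hbox
      obtain ⟨w'', hw'⟩ := hR.serial hD w'
      exact hα w'' (hR.trans h4 _ _ _ hw hw') (hbox w'' hw')
    · exact fun hT hα w' hw hbox => hα w' hw (hbox w' (hR.refl hT w'))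
    · intro h5
      refine ⟨fun hα w' hw hbox => hα fun w'' hw' => hbox w'' (hR.eucl h5 _ _ _ hw hw'), ?_⟩
      by_contra! hcon
      obtain ⟨⟨x, hx, hx'⟩, y, hy, hy'⟩ := hcon
      -- In a Euclidean frame the successors `x` and `y` of `w` see each other, so whatever `x` sees
      -- is seen by `y`.
      exact hx' fun z hz => hy' z (hR.eucl h5 _ _ _ (hR.eucl h5 _ _ _ hx hy) hz)
    · rw [forall_sat_and_forall_not_sat_iff, forall_sat_and_forall_not_sat_iff]

/-- The valuations given by the worlds of a Kripke model on an `L`-frame are level-valuations. -/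
lemma IsFrame.kripkeValue_mem_levelValuations (hR : IsFrame L R) (w : W) :
    kripkeValue R V w ∈ levelValuations At L.matrix := by
  refine Set.mem_iInter.2 fun n => ?_
  induction n generalizing w with
  | zero =>
    refine ⟨hR.kripkeValue_isValuation V w, ?_⟩
    simp only [kripkeValue, ofBits_mem_ff_tt, decide_eq_true_eq,
      forall_sat_and_forall_not_sat_iff]
    exact fun ⟨_, h⟩ _ => h
  | succ n ih =>
    refine ⟨ih w, fun α hα => ?_⟩
    -- The induction covers all worlds at once, so `hα` applies to the valuation of every `w'`.
    have hsat (w' : W) : Sat R V α w' := by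
      have := (Finset.mem_inter.1 (hα _ (ih w'))).2
      simpa [kripkeValue, ofBits_mem_setD] using this
    simp only [kripkeValue, ofBits_mem_T_tt, decide_eq_true_eq]
    exact ⟨hsat w, fun w' _ => hsat w'⟩

end Kripke

/-! ### From models on a domain to Kripke models -/

/-- Necessitation along an edge. -/
def Nec (w w' : Λ → TV) : Prop :=
  ∀ α : Λ, (w α ∈ setN → w' α ∈ setD) ∧ (w α ∈ setI → w' α ∉ setD)

/-- What is necessary or impossible in `w` is so in `w'`. -/
def Persists (w w' : Λ → TV) : Prop :=
  ∀ α : Λ, (w α ∈ setN → w' α ∈ setN) ∧ (w α ∈ setI → w' α ∈ setI)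

lemma Persists.refl (w : Λ → TV) : Persists w w := fun _ => ⟨id, id⟩

lemma Persists.trans {x y z : Λ → TV} (h : Persists x y) (h' : Persists y z) : Persists x z :=
  fun α => ⟨fun hx => (h' α).1 ((h α).1 hx), fun hx => (h' α).2 ((h α).2 hx)⟩

lemma Persists.nec {x y z : Λ → TV} (h : Persists x y) (h' : Nec y z) : Nec x z :=
  fun α => ⟨fun hx => (h' α).1 ((h α).1 hx), fun hx => (h' α).2 ((h α).2 hx)⟩

/-- Contraposition, as `setP` and `setPN` are the complements of `setI` and `setN`: condition B is
necessitation along the reversed edge. -/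
lemma nec_of_B {w w' : Λ → TV}
    (h : ∀ α : Λ, (w α ∈ setD → w' α ∈ setP) ∧ (w α ∉ setD → w' α ∈ setPN)) : Nec w' w := by
  intro α
  have := h α
  rw [mem_setP_iff, mem_setPN_iff] at this
  tauto

lemma persists_of_five {w w' : Λ → TV}
    (h : ∀ α : Λ, (w α ∈ setP → w' α ∈ setP) ∧ (w α ∈ setPN → w' α ∈ setPN)) :
    Persists w' w := by
  intro α
  have := h α
  simp only [mem_setP_iff, mem_setPN_iff] at this
  tauto

namespace IsModel

variable {S : Set (Λ → TV)} {R : (Λ → TV) → (Λ → TV) → Prop}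

lemma exists_rel_of_D (h : IsModel L Λ S R) (hD : .D ∈ L.axioms) (α : Λ) {w : Λ → TV}
    (hw : w ∈ S) : ∃ w', R w w' := by
  by_cases hP : w α ∈ setP
  · obtain ⟨w', -, hR, -⟩ := h.exists_designated w hw α hP
    exact ⟨w', hR⟩
  · have hI : w α ∈ setI := by simpa [mem_setP_iff] using hP
    obtain ⟨w', -, hR, -⟩ := h.exists_not_designated w hw α (((h.cond _ hD) w hw α).2 hI)
    exact ⟨w', hR⟩

lemma persists_of_rel (h : IsModel L Λ S R) (h5 : .five ∈ L.axioms) {w w' : Λ → TV}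
    (hw : R w w') : Persists w' w :=
  persists_of_five ((h.cond _ h5).1 w w' hw)

/-- The second clause of condition 5 asks for necessity at both `w` and `w'`; by the first clause,
necessity at `w'` already gives it at `w`. -/
lemma persists_of_rel_of_rel (h : IsModel L Λ S R) (h5 : .five ∈ L.axioms) {w w' w'' : Λ → TV}
    (hw : R w w') (hw' : R w w'' ∨ R w' w'') : Persists w' w'' := fun α =>
  ⟨fun hN => ((h.cond _ h5).2 w w' w'' hw hw' α).1 ((h.persists_of_rel h5 hw α).1 hN) hN,
    fun hI => ((h.cond _ h5).2 w w' w'' hw hw' α).2 ((h.persists_of_rel h5 hw α).2 hI) hI⟩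

/-- The relation of a model for an axiom set without `5`, or with `4` and `5`, enlarges to one
with the frame conditions. -/
lemma exists_isFrame_of_four_of_five (h : IsModel L Λ S R) (α : Λ)
    (hL : .five ∈ L.axioms → .four ∈ L.axioms)
    (hB : .B ∈ L.axioms → .four ∈ L.axioms → .five ∈ L.axioms) :
    ∃ R' : S → S → Prop, (∀ w w' : S, R w w' → R' w w') ∧
      (∀ w w' : S, R' w w' → Nec w.1 w'.1) ∧ IsFrame L R' := by
  -- All pairs compatible with the axioms are related. B and 5 are read backwards along the edge, so
  -- symmetry swaps the clauses in pairs; this is where B with 4 must bring 5, and 5 must bring 4.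
  let R' : S → S → Prop := fun w w' => Nec w.1 w'.1 ∧ (.B ∈ L.axioms → Nec w'.1 w.1) ∧
    (.four ∈ L.axioms → Persists w.1 w'.1) ∧ (.five ∈ L.axioms → Persists w'.1 w.1)
  have hsub (w w' : S) (hw : R w w') : R' w w' :=
    ⟨h.nec _ _ hw, fun hB => nec_of_B (h.cond _ hB _ _ hw), fun h4 => h.cond _ h4 _ _ hw,
      fun h5 => h.persists_of_rel h5 hw⟩
  refine ⟨R', hsub, fun w w' hw => hw.1, ?_, ?_, ?_, ?_, ?_⟩
  · intro hD w
    obtain ⟨w', hw⟩ := h.exists_rel_of_D hD α w.2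
    exact ⟨⟨w', (h.rel_mem _ _ hw).2⟩, hsub _ _ hw⟩
  · intro hT w
    have hn : Nec w.1 w.1 := h.cond _ hT w.1 w.2
    exact ⟨hn, fun _ => hn, fun _ => .refl _, fun _ => .refl _⟩
  · intro hB' w w' hw
    exact ⟨hw.2.1 hB', fun _ => hw.1, fun h4 => hw.2.2.2 (hB hB' h4), fun h5 => hw.2.2.1 (hL h5)⟩
  · intro h4 x y z hx hy
    exact ⟨(hx.2.2.1 h4).nec hy.1, fun hB' => (hy.2.2.2 (hB hB' h4)).nec (hx.2.1 hB'),
      fun _ => (hx.2.2.1 h4).trans (hy.2.2.1 h4), fun h5 => (hy.2.2.2 h5).trans (hx.2.2.2 h5)⟩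
  · intro h5 x y z hx hy
    have h4 := hL h5
    exact ⟨(hx.2.2.2 h5).nec hy.1, fun _ => (hy.2.2.2 h5).nec hx.1,
      fun _ => (hx.2.2.2 h5).trans (hy.2.2.1 h4), fun _ => (hy.2.2.2 h5).trans (hx.2.2.1 h4)⟩

/-- The relation of a model of `5` enlarges to a Euclidean one. -/
lemma exists_isFrame_of_five (h : IsModel L Λ S R) (α : Λ) (h5 : .five ∈ L.axioms)
    (h4 : .four ∉ L.axioms) (hB : .B ∉ L.axioms) (hT : .T ∉ L.axioms) :
    ∃ R' : S → S → Prop, (∀ w w' : S, R w w' → R' w w') ∧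
      (∀ w w' : S, R' w w' → Nec w.1 w'.1) ∧ IsFrame L R' := by
  -- Without 4, necessity need not persist from a world without predecessors to its successors.
  -- Among worlds with a predecessor (`C`) edges stay inside a class of `E`, and `Nec` is reflexive
  -- there, so any two such worlds in one class can be related. Any `w` may moreover see the worlds
  -- of `C` that are equivalent to one of its old successors, if `Nec` allows.
  let E : (Λ → TV) → (Λ → TV) → Prop := fun x y => Persists x y ∧ Persists y x
  have hEt {x y z : Λ → TV} (hx : E x y) (hy : E y z) : E x z :=
    ⟨hx.1.trans hy.1, hy.2.trans hx.2⟩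
  let C : (Λ → TV) → Prop := fun y => ∃ x, R x y
  have hCE {x y z : Λ → TV} (hx : R x y) (hy : R x z) : E y z :=
    ⟨h.persists_of_rel_of_rel h5 hx (.inl hy), h.persists_of_rel_of_rel h5 hy (.inl hx)⟩
  have hCs {y z : Λ → TV} (hy : C y) (hz : R y z) : E y z := by
    obtain ⟨x, hx⟩ := hy
    exact ⟨h.persists_of_rel_of_rel h5 hx (.inr hz), h.persists_of_rel h5 hz⟩
  have hCn {y : Λ → TV} (hy : C y) : Nec y y := by
    obtain ⟨x, hx⟩ := hy
    exact (h.persists_of_rel h5 hx).nec (h.nec _ _ hx)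
  let R' : S → S → Prop := fun w y => C y ∧ Nec w.1 y.1 ∧
    (C w ∧ E w y ∨ ∃ x, R w x ∧ E x y)
  have hsub (w w' : S) (hw : R w w') : R' w w' :=
    ⟨⟨w, hw⟩, h.nec _ _ hw, .inr ⟨w', hw, .refl _, .refl _⟩⟩
  refine ⟨R', hsub, fun w w' hw => hw.2.1, ?_, fun h' => absurd h' hT, fun h' => absurd h' hB,
    fun h' => absurd h' h4, ?_⟩
  · intro hD w
    obtain ⟨w', hw⟩ := h.exists_rel_of_D hD α w.2
    exact ⟨⟨w', (h.rel_mem _ _ hw).2⟩, hsub _ _ hw⟩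
  · rintro - x y z ⟨hCy, -, hy⟩ ⟨hCz, -, hz⟩
    have hyz : E y z := by
      rcases hy with ⟨hCx, hy⟩ | ⟨a, ha, hy⟩ <;> rcases hz with ⟨hCx, hz⟩ | ⟨b, hb, hz⟩
      · exact hEt hy.symm hz
      · exact hEt hy.symm (hEt (hCs hCx hb) hz)
      · exact hEt hy.symm (hEt (hCs hCx ha).symm hz)
      · exact hEt hy.symm (hEt (hCE ha hb) hz)
    exact ⟨hCz, hyz.1.nec (hCn hCz), .inl ⟨hCy, hyz⟩⟩

/-- The relation of a model enlarges to one with the frame conditions, keeping necessitation. -/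
lemma exists_isFrame (h : IsModel L Λ S R) :
    ∃ R' : S → S → Prop, (∀ w w' : S, R w w' → R' w w') ∧
      (∀ w w' : S, R' w w' → Nec w.1 w'.1) ∧ IsFrame L R' := by
  rcases isEmpty_or_nonempty Λ with hΛ | ⟨⟨α⟩⟩
  -- Without formulas, `R` may lack the successors required by D, but necessitation is vacuous and
  -- the total relation is allowed.
  · exact ⟨fun _ _ => True, fun _ _ _ => trivial, fun _ _ _ α => hΛ.elim α,
      fun _ w => ⟨w, trivial⟩, fun _ _ => trivial, fun _ _ _ _ => trivial,
      fun _ _ _ _ _ _ => trivial, fun _ _ _ _ _ _ => trivial⟩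
  · by_cases h5 : .five ∈ L.axioms ∧ .four ∉ L.axioms
    · have : ∀ L : Logic, .five ∈ L.axioms ∧ .four ∉ L.axioms →
          .B ∉ L.axioms ∧ .T ∉ L.axioms := by decide
      exact h.exists_isFrame_of_five α h5.1 h5.2 (this L h5).1 (this L h5).2
    · have : ∀ L : Logic, .B ∈ L.axioms → .four ∈ L.axioms → .five ∈ L.axioms := by decide
      exact h.exists_isFrame_of_four_of_five α (by tauto) (this L)

variable {R' : S → S → Prop}

/-- New edges do no harm by necessitation; the converse uses the old witnesses, which `R'` keeps. -/
lemma mem_setN_iff (h : IsModel L Λ S R) (hsub : ∀ w w' : S, R w w' → R' w w')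
    (hnec : ∀ w w' : S, R' w w' → Nec w.1 w'.1) (w : S) (α : Λ) :
    w.1 α ∈ setN ↔ ∀ w' : S, R' w w' → w'.1 α ∈ setD := by
  refine ⟨fun hN w' hw => (hnec w w' hw α).1 hN, fun hall => ?_⟩
  by_contra hN
  obtain ⟨w', hw', hR, hd⟩ := h.exists_not_designated w.1 w.2 α ((mem_setPN_iff _).2 hN)
  exact hd (Finset.mem_inter.2 ⟨(h.valuation w' hw').values α, hall ⟨w', hw'⟩ (hsub _ _ hR)⟩)

lemma mem_setI_iff (h : IsModel L Λ S R) (hsub : ∀ w w' : S, R w w' → R' w w')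
    (hnec : ∀ w w' : S, R' w w' → Nec w.1 w'.1) (w : S) (α : Λ) :
    w.1 α ∈ setI ↔ ∀ w' : S, R' w w' → w'.1 α ∉ setD := by
  refine ⟨fun hI w' hw => (hnec w w' hw α).2 hI, fun hall => ?_⟩
  by_contra hI
  obtain ⟨w', hw', hR, hd⟩ := h.exists_designated w.1 w.2 α ((mem_setP_iff _).2 hI)
  exact hall ⟨w', hw'⟩ (hsub _ _ hR) (Finset.mem_inter.1 hd).2

/-- Truth at the worlds of a model is designation, for the formulas of the domain. -/
lemma sat_iff (h : IsModel L Λ S R) (hΛ : SubformulaClosed Λ)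
    (hN : ∀ (w : S) (α : Λ), w.1 α ∈ setN ↔ ∀ w' : S, R' w w' → w'.1 α ∈ setD)
    (α : Form At) (hα : α ∈ Λ) (w : S) :
    Sat R' (fun p w => ∃ hp : .atom p ∈ Λ, w.1 ⟨_, hp⟩ ∈ setD) α w ↔ w.1 ⟨α, hα⟩ ∈ setD := by
  induction α generalizing w with
  | atom p => exact ⟨fun ⟨_, hd⟩ => hd, fun hd => ⟨hα, hd⟩⟩
  | bot =>
    have := (h.valuation w.1 w.2).bot ⟨_, hα⟩ rfl
    exact iff_of_false id (notMem_setD_of_mem_botTable _ (Finset.mem_inter.1 this).1)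
  | imp α β ihα ihβ =>
    have hα' := hΛ.imp_left α β hα
    have hβ' := hΛ.imp_right α β hα
    have := (h.valuation w.1 w.2).imp ⟨α, hα'⟩ ⟨β, hβ'⟩ ⟨_, hα⟩ rfl
    rw [mem_setD_of_mem_impTable _ _ _ (Finset.mem_inter.1 this).1]
    exact imp_congr (ihα hα' w) (ihβ hβ' w)
  | box α ih =>
    have hα' := hΛ.box α hα
    have := (h.valuation w.1 w.2).box ⟨α, hα'⟩ ⟨_, hα⟩ rfl
    rw [mem_setD_of_mem_boxTable _ _ _ this, hN]
    exact forall_congr' fun w' => imp_congr_right fun _ => ih hα' w'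

end IsModel

end ModalCube

theorem mainTheorem5 {At : Type u} (L : ModalCube.Logic) (Λ : Set (ModalCube.Form At))
    (hΛ : ModalCube.SubformulaClosed Λ) (v : Λ → ModalCube.TV)
    (hv : ModalCube.IsPartialLevelValuation L Λ v) :
    ∃ u ∈ ModalCube.levelValuations At L.matrix, ∀ α : Λ, u α.1 = v α := by
  obtain ⟨S, R, h, hvS⟩ := hv
  obtain ⟨R', hsub, hnec, hR'⟩ := h.exists_isFrame
  have hN := h.mem_setN_iff hsub hnec
  -- Atoms outside `Λ` are made false everywhere; the truth lemma never meets them.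
  refine ⟨_, hR'.kripkeValue_mem_levelValuations
    (fun p w => ∃ hp : .atom p ∈ Λ, w.1 ⟨_, hp⟩ ∈ ModalCube.setD) ⟨v, hvS⟩, fun α => ?_⟩
  have hsat := h.sat_iff hΛ hN α.1 α.2
  rw [← ModalCube.ofBits_self (v α)]
  unfold ModalCube.kripkeValue
  congr 1 <;> rw [decide_eq_decide]
  · exact hsat _
  · exact (forall₂_congr fun w _ => hsat w).trans (hN ⟨v, hvS⟩ α).symm
  · exact (forall₂_congr fun w _ => not_congr (hsat w)).trans
      (h.mem_setI_iff hsub hnec ⟨v, hvS⟩ α).symm
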